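/- Fix an integer $g\ge 1$ and let $\underline c=(c_0,\dots,c_g)$ and $t$ be indeterminates. For an integer $k\ge 0$ let $V_k^{\pm}$ (with $k+1$ columns) and $W_k^{\pm}$ (with $k+2$ columns) be the following matrices, with rows and columns numbered from $0$. The matrices $V_k^+,W_k^+$ have $\lfloor (k+3)/2\rfloor$ rows, and their $(i,j)$ entry is $1$ if $j=i$ or $j=k+1-i$, and $0$ otherwise. The matrices $V_k^-,W_k^-$ have $\lfloor (k+2)/2\rfloor$ rows, and their $(i,j)$ entry is $1$ if $j=i$, $-1$ if $j=k+1-i$, and $0$ otherwise. Put $$P_k(m)=\begin{bmatrix}V_k^+&0\\0&V_k^-\\ [\,0\ I_k\,]&-m\,[\,0\ I_k\,]\end{bmatrix},\qquad Q_k=\begin{bmatrix}W_k^+&0\\0&W_k^-\\0&0\end{bmatrix},$$ of sizes $(2k+2)\times(2k+2)$ and $(2k+2)\times(2k+4)$, where $[\,0\ I_k\,]$ is the $k\times k$ identity matrix preceded by a zero column. Let $a=(c_0t^{g},c_1t^{g-1},\dots,c_{g-1}t,c_g,c_{g-1}t^{-1},\dots,c_0t^{-g})$ and let $v(0)$ be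 the column vector of length $4g+2$ obtained by writing $a$ twice. For $1\le n\le 2g$ define successively, writing $v[j]$ for the $j$-th component of $v$ (numbered from $1$), $$m_{2g-n}=\frac{v(n-1)[1]+v(n-1)[2g-n+2]}{v(n-1)[2g-n+3]-v(n-1)[4g-2n+4]},\qquad v(n)=P_{2g-n}(m_{2g-n})^{-1}Q_{2g-n}\,v(n-1),$$ and put $m_{2g}=\dfrac{t^{g}+t^{-g}}{t^{g}-t^{-g}}$. Define the rational functions $R_n(\underline c;t)\in\mathbb Q(c_0,\dots,c_g,t)$ for $1\le n\le 2g$ by $$R_{2J+1}=\prod_{j=0}^{J}\frac{m_{2g-(2j+1)}}{m_{2g-2j}},\qquad R_{2J+2}=\prod_{j=0}^{J}\frac{m_{2g-(2j+2)}}{m_{2g-(2j+1)}}.$$ **Theorem.** Let $q>1$ and let $$P_g(x)=\sum_{k=0}^{g-1}c_k\,(x^{2g-k}+x^{k})+c_g\,x^{g}$$ be a self-reciprocal polynomial of degree $2g>0$ with real coefficients $\underline c=(c_0,\dots,c_g)\in\mathbb R^{g+1}$, $c_0\ne 0$. Then all zeros of $P_g$ in $\mathbb C$ lie on the unit circle $T=\{z\in\mathbb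 C: |z|=1\}$ (multiple zeros being allowed) if and only if, for every $1\le n\le 2g$ and every real $\omega>0$, $$R_n(\underline c;q^{\omega})>0\quad\text{and}\quad R_n(\underline c;q^{\omega})^{-1}>0,$$ that is, the rational functions $R_n$ and $R_n^{-1}$ both have a finite positive real value at the point $(\underline c,q^{\omega})$. Here a rational function has a finite value at a point if it can be written as a quotient of two polynomials whose denominator does not vanish there, and its value is then the quotient of their values. -/

import Mathlib

open Polynomial Matrix

noncomputable section

namespace SelfReciprocal

/-- The self-reciprocal polynomial
`P_g(x) = ∑_{k=0}^{g-1} c_k (x^(2g-k) + x^k) + c_g x^g` with real coefficients. -/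
def poly (g : ℕ) (c : Fin (g + 1) → ℝ) : ℝ[X] :=
  (∑ k : Fin g, C (c k.castSucc) * (X ^ (2 * g - (k : ℕ)) + X ^ (k : ℕ)))
    + C (c (Fin.last g)) * X ^ g

section LinearSystem

/-! The linear system over an arbitrary field `K`. Indices of rows and columns start at `0`.
For `k = 0` and `k = 1` the general block formulas give the separately displayed matrices. -/

variable {K : Type*} [Field K]

/-- The pattern of `V_k^+` (with `k + 1` columns) and of `W_k^+` (with `k + 2` columns): row `i` has
the entry `1` in the columns `i` and `k + 1 - i`, as far as these columns exist. There are
`(k + 3) / 2` rows if `k` is odd and `(k + 2) / 2` rows if `k` is even. -/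
def plusBlock (K : Type*) [Field K] (k l : ℕ) : Matrix (Fin ((k + 3) / 2)) (Fin l) K :=
  Matrix.of fun i j => if (j : ℕ) = i ∨ (i : ℕ) + j = k + 1 then 1 else 0

/-- The pattern of `V_k^-` (with `k + 1` columns) and of `W_k^-` (with `k + 2` columns): row `i` has
the entry `1` in column `i` and `-1` in column `k + 1 - i`, as far as these columns exist. There are
`(k + 1) / 2` rows if `k` is odd and `(k + 2) / 2` rows if `k` is even. -/
def minusBlock (K : Type*) [Field K] (k l : ℕ) : Matrix (Fin ((k + 2) / 2)) (Fin l) K :=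
  Matrix.of fun i j => if (j : ℕ) = i then 1 else if (i : ℕ) + j = k + 1 then -1 else 0

/-- The `k × (k + 1)` matrix `[0 I_k]`. -/
def zeroId (K : Type*) [Field K] (k : ℕ) : Matrix (Fin k) (Fin (k + 1)) K :=
  Matrix.of fun i j => if (j : ℕ) = i + 1 then 1 else 0

/-- The rows of the three horizontal blocks of `P_k` and `Q_k`, from top to bottom, are the
`2k + 2` row indices, here split into two halves of length `k + 1`. -/
def rowEquiv (k : ℕ) :
    (Fin ((k + 3) / 2) ⊕ Fin ((k + 2) / 2)) ⊕ Fin k ≃ Fin (k + 1) ⊕ Fin (k + 1) :=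
  ((Equiv.sumCongr finSumFinEquiv (Equiv.refl _)).trans finSumFinEquiv).trans
    ((finCongr (by omega)).trans finSumFinEquiv.symm)

/-- The `(2k + 2) × (2k + 2)` matrix `P_k(m)`. -/
def matP (k : ℕ) (m : K) : Matrix (Fin (k + 1) ⊕ Fin (k + 1)) (Fin (k + 1) ⊕ Fin (k + 1)) K :=
  (fromRows
    (fromBlocks (plusBlock K k (k + 1)) 0 0 (minusBlock K k (k + 1)))
    (fromCols (zeroId K k) (-m • zeroId K k))).submatrix (rowEquiv k).symm id

/-- The `(2k + 2) × (2k + 4)` matrix `Q_k`. -/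
def matQ (K : Type*) [Field K] (k : ℕ) :
    Matrix (Fin (k + 1) ⊕ Fin (k + 1)) (Fin (k + 2) ⊕ Fin (k + 2)) K :=
  (fromRows
    (fromBlocks (plusBlock K k (k + 2)) 0 0 (minusBlock K k (k + 2)))
    (0 : Matrix (Fin k) (Fin (k + 2) ⊕ Fin (k + 2)) K)).submatrix (rowEquiv k).symm id

/-- The quotient `(v[1] + v[k+2]) / (v[k+3] - v[2k+4])` of a vector `v` of length `2k + 4`
(components numbered from `1`). -/
def mOf {k : ℕ} (v : Fin (k + 2) ⊕ Fin (k + 2) → K) : K :=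
  (v (Sum.inl 0) + v (Sum.inl (Fin.last _))) / (v (Sum.inr 0) - v (Sum.inr (Fin.last _)))

/-- The `j`-th entry (`0 ≤ j ≤ 2g`) of the initial column `a_{g,ω}(0) = b_{g,ω}(0)`, with `t` in the
place of `q^ω`: it is `c_j t^(g-j)` for `j ≤ g` and `c_(2g-j) t^(g-j)` for `g ≤ j ≤ 2g`. -/
def initEntry (g : ℕ) (c : Fin (g + 1) → K) (t : K) (j : ℕ) : K :=
  c ⟨min j (2 * g - j), by omega⟩ * t ^ ((g : ℤ) - (j : ℤ))

/-- `vec g c t n k` is the vector `v_g(n)` of length `2k + 2`, where `k = 2g - n`: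
`v_g(0)` is the initial vector, and `v_g(n) = P_k(m_k)⁻¹ Q_k v_g(n-1)` with
`m_k = (v_g(n-1)[1] + v_g(n-1)[k+2]) / (v_g(n-1)[k+3] - v_g(n-1)[2k+4])`.
It is used only for `n + k = 2g`. -/
def vec (g : ℕ) (c : Fin (g + 1) → K) (t : K) : ℕ → (k : ℕ) → (Fin (k + 1) ⊕ Fin (k + 1) → K)
  | 0, _ => Sum.elim (fun j => initEntry g c t j) (fun j => initEntry g c t j)
  | n + 1, k => (matP k (mOf (vec g c t n (k + 1))))⁻¹ *ᵥ (matQ K k *ᵥ vec g c t n (k + 1))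

/-- `mCoeff g c t n` is `m_{2g-n}(c; t)` for `0 ≤ n ≤ 2g`. -/
def mCoeff (g : ℕ) (c : Fin (g + 1) → K) (t : K) : ℕ → K
  | 0 => (t ^ g + (t ^ g)⁻¹) / (t ^ g - (t ^ g)⁻¹)
  | n + 1 => mOf (vec g c t n (2 * g - (n + 1) + 1))

/-- `R_n(c; t)` for `0 ≤ n ≤ 2g`, where `J = (n - 1) / 2` for `n = 2J + 1` and for `n = 2J + 2`. -/
def R (g : ℕ) (c : Fin (g + 1) → K) (t : K) (n : ℕ) : K :=
  if n = 0 then 1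
  else if n % 2 = 1 then
    ∏ j ∈ Finset.range ((n - 1) / 2 + 1), mCoeff g c t (2 * j + 1) / mCoeff g c t (2 * j)
  else
    ∏ j ∈ Finset.range ((n - 1) / 2 + 1), mCoeff g c t (2 * j + 2) / mCoeff g c t (2 * j + 1)

end LinearSystem

/-- The field `ℚ(c_0, …, c_g, t)` of rational functions; the indeterminate `c_i` has the index
`some i`, and the indeterminate `t`, which stands for `q^ω`, has the index `none`. -/
abbrev RatFun (g : ℕ) : Type := FractionRing (MvPolynomial (Option (Fin (g + 1))) ℚ)

/-- The rational function `R_n(c; t)` as an element of `ℚ(c_0, …, c_g, t)`. -/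
def ratR (g n : ℕ) : RatFun g :=
  R g (fun i => algebraMap (MvPolynomial (Option (Fin (g + 1))) ℚ) (RatFun g)
      (MvPolynomial.X (some i)))
    (algebraMap (MvPolynomial (Option (Fin (g + 1))) ℚ) (RatFun g) (MvPolynomial.X none)) n

/-- The rational function `f` is finite, with value `y`, at the numerical point `(c, t)`: it is a
quotient of two polynomials whose denominator does not vanish there, and `y` is the quotient of
their values. -/
def HasValueAt {g : ℕ} (f : RatFun g) (c : Fin (g + 1) → ℝ) (t y : ℝ) : Prop :=
  ∃ a b : MvPolynomial (Option (Fin (g + 1))) ℚ,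
    MvPolynomial.aeval (fun o : Option (Fin (g + 1)) => o.elim t c) b ≠ 0 ∧
    f = algebraMap _ (RatFun g) a / algebraMap _ (RatFun g) b ∧
    y = MvPolynomial.aeval (fun o : Option (Fin (g + 1)) => o.elim t c) a /
      MvPolynomial.aeval (fun o : Option (Fin (g + 1)) => o.elim t c) b

/-- The value of `f` at `(c, t)` is a finite positive real number. -/
def PosAt {g : ℕ} (f : RatFun g) (c : Fin (g + 1) → ℝ) (t : ℝ) : Prop :=
  ∃ y : ℝ, HasValueAt f c t y ∧ 0 < y

end SelfReciprocal

end

/-! As long as the `m`'s do not vanish, `v(n)` has the form `(μ f, f)`: here `f` is the `n`-th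
Schur–Cohn iterate of `f_t(x) = t^g P_g(x/t)`, of formal degree `2g - n`, and `μ = m_{2g-n}` (but `μ
= 1` for `n = 0`). If `γ_n` is the last coefficient of `f` divided by `f 0`, then `m_{2g-n-1} = μ (1
+ γ_n) / (1 - γ_n)`, and solving the linear system is one Schur–Cohn step (`inv_matP_mulVec_matQ`,
`vec_eq`). Hence `R_{n+2} / R_n = (1 + γ_{n+1}) / (1 - γ_{n+1})`, which is positive exactly when
`|γ_{n+1}| < 1`; for `t > 1` the bound on `γ_0 = t^(-2g)` is automatic.

By the Schur–Cohn criterion (`discStable_initEntry_iff`) all `|γ_n| < 1` iff `f_t` has no zero in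
the closed unit disc. The zeros of `f_t` are `t` times those of `P_g`, which are invariant under `z
↦ 1/z`; so this holds for every `t > 1` iff all zeros of `P_g` lie on the circle
(`roots_on_circle_iff`).

Since `R_n` lives in a function field, the linear algebra is done there and then evaluated; the
bounds on the earlier `γ_i` keep the denominators nonzero at the point (`posAt_mCoeff_div_iff`). -/

noncomputable section

namespace SelfReciprocal

/-! ### The linear system as a Schur–Cohn step -/

section LinearAlgebra

variable {K : Type*} [Field K]

/-- Extending a vector of length `k + 1` by a zero in position `k + 1` lets one row formula serve
both the `V` blocks and the `W` blocks. -/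
theorem sum_fin_eq_sum_range {k l : ℕ} (hl : l ≤ k + 2) (h : ℕ → K)
    (h0 : ∀ j, l ≤ j → j < k + 2 → h j = 0) (φ : ℕ → K) :
    ∑ j : Fin l, φ j * h j = ∑ j ∈ Finset.range (k + 2), φ j * h j := by
  rw [Fin.sum_univ_eq_sum_range (fun j => φ j * h j)]
  apply Finset.sum_subset (Finset.range_mono hl)
  intro j hj hj'
  simp only [Finset.mem_range, not_lt] at hj hj'
  rw [h0 j hj' hj, mul_zero]

theorem plusBlock_mulVec {k l : ℕ} (hl : l ≤ k + 2) (h : ℕ → K)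
    (h0 : ∀ j, l ≤ j → j < k + 2 → h j = 0) (i : Fin ((k + 3) / 2)) :
    (plusBlock K k l *ᵥ fun j => h j) i =
      if 2 * (i : ℕ) = k + 1 then h i else h i + h (k + 1 - i) := by
  have hi := i.2
  have := sum_fin_eq_sum_range hl h h0
    (fun j => if j = (i : ℕ) ∨ (i : ℕ) + j = k + 1 then (1 : K) else 0)
  simp only [mulVec, dotProduct, plusBlock, of_apply]
  rw [this]
  simp only [ite_mul, one_mul, zero_mul]
  -- In the middle row the columns `i` and `k + 1 - i` coincide and carry a single `1`. The minus
  -- block has too few rows to reach this case.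
  split_ifs with hk
  · rw [Finset.sum_eq_single_of_mem (i : ℕ) (by simp; omega)]
    · simp
    · intro j _ hj
      rw [if_neg (by omega)]
  · rw [← Finset.sum_filter, show (Finset.range (k + 2)).filter
      (fun j => j = (i : ℕ) ∨ (i : ℕ) + j = k + 1) = {(i : ℕ), k + 1 - i} by
        ext j; simp; omega, Finset.sum_pair (by omega)]

theorem minusBlock_mulVec {k l : ℕ} (hl : l ≤ k + 2) (h : ℕ → K)
    (h0 : ∀ j, l ≤ j → j < k + 2 → h j = 0) (i : Fin ((k + 2) / 2)) :
    (minusBlock K k l *ᵥ fun j => h j) i = h i - h (k + 1 - i) := by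
  have hi := i.2
  have := sum_fin_eq_sum_range hl h h0
    (fun j => if j = (i : ℕ) then (1 : K) else if (i : ℕ) + j = k + 1 then -1 else 0)
  simp only [mulVec, dotProduct, minusBlock, of_apply]
  rw [this, ← Finset.sum_subset (s₁ := {(i : ℕ), k + 1 - i}), Finset.sum_pair (by omega)]
  · rw [if_pos rfl, if_neg (by omega), if_pos (by omega)]
    ring
  · intro j; simp; omega
  · intro j _ hj
    simp only [Finset.mem_insert, Finset.mem_singleton, not_or] at hj
    rw [if_neg hj.1, if_neg (by omega), zero_mul]

theorem zeroId_mulVec {k : ℕ} (h : ℕ → K) (i : Fin k) :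
    (zeroId K k *ᵥ fun j => h j) i = h (i + 1) := by
  simp only [mulVec, dotProduct, zeroId, of_apply]
  rw [Finset.sum_eq_single (i.succ : Fin (k + 1))]
  · simp
  · intro j _ hj
    rw [if_neg (fun h => hj (Fin.ext (by simpa using h))), zero_mul]
  · simp

theorem matP_mulVec {k : ℕ} (m : K) (a b : Fin (k + 1) → K) :
    (matP k m *ᵥ Sum.elim a b) ∘ rowEquiv k =
      Sum.elim (Sum.elim (plusBlock K k (k + 1) *ᵥ a) (minusBlock K k (k + 1) *ᵥ b))
        (zeroId K k *ᵥ a - m • (zeroId K k *ᵥ b)) := by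
  have : (matP k m *ᵥ Sum.elim a b) ∘ rowEquiv k = (fromRows
    (fromBlocks (plusBlock K k (k + 1)) 0 0 (minusBlock K k (k + 1)))
    (fromCols (zeroId K k) (-m • zeroId K k))) *ᵥ Sum.elim a b := by
    ext i
    simp [matP, mulVec, submatrix]
  rw [this, fromRows_mulVec, fromBlocks_mulVec, fromCols_mulVec]
  simp [Matrix.neg_mulVec, Matrix.smul_mulVec, sub_eq_add_neg]

theorem matQ_mulVec {k : ℕ} (a b : Fin (k + 2) → K) :
    (matQ K k *ᵥ Sum.elim a b) ∘ rowEquiv k =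
      Sum.elim (Sum.elim (plusBlock K k (k + 2) *ᵥ a) (minusBlock K k (k + 2) *ᵥ b)) 0 := by
  have : (matQ K k *ᵥ Sum.elim a b) ∘ rowEquiv k = (fromRows
    (fromBlocks (plusBlock K k (k + 2)) 0 0 (minusBlock K k (k + 2)))
    (0 : Matrix (Fin k) (Fin (k + 2) ⊕ Fin (k + 2)) K)) *ᵥ Sum.elim a b := by
    ext i
    simp [matQ, mulVec, submatrix]
  rw [this, fromRows_mulVec, fromBlocks_mulVec]
  simp

/-- For a kernel vector `(a, b)` the bottom block gives `a_i = m b_i` for `1 ≤ i ≤ k`. Then the plus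
rows say `m (b_i + b_{k+1-i}) = 0` and the minus rows `b_i = b_{k+1-i}`, so `2 m b_i = 0`. In row
`0` the partner column `k + 1` is missing, which kills `a_0` and `b_0` directly. -/
theorem isUnit_matP [CharZero K] (k : ℕ) {m : K} (hm : m ≠ 0) : IsUnit (matP k m) := by
  rw [← Matrix.mulVec_injective_iff_isUnit]
  rw [← Matrix.coe_mulVecLin, ← LinearMap.ker_eq_bot, LinearMap.ker_eq_bot']
  intro x hx
  rw [Matrix.mulVecLin_apply] at hx
  let a : ℕ → K := fun j => if h : j < k + 1 then x (Sum.inl ⟨j, h⟩) else 0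
  let b : ℕ → K := fun j => if h : j < k + 1 then x (Sum.inr ⟨j, h⟩) else 0
  have hxe : x = Sum.elim (fun j : Fin (k + 1) => a j) (fun j : Fin (k + 1) => b j) := by
    ext (j | j)
    · simp only [Sum.elim_inl, a, dif_pos j.2]
    · simp only [Sum.elim_inr, b, dif_pos j.2]
  have ha : ∀ j, k + 1 ≤ j → j < k + 2 → a j = 0 := fun j hj _ => dif_neg (by omega)
  have hb : ∀ j, k + 1 ≤ j → j < k + 2 → b j = 0 := fun j hj _ => dif_neg (by omega)
  have key := matP_mulVec m (fun j : Fin (k + 1) => a j) (fun j : Fin (k + 1) => b j)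
  rw [← hxe, hx] at key
  have hp : ∀ i : ℕ, i < (k + 3) / 2 →
      (if 2 * i = k + 1 then a i else a i + a (k + 1 - i)) = 0 := by
    intro i hi
    have := congrFun key (Sum.inl (Sum.inl ⟨i, hi⟩))
    simp only [Sum.elim_inl] at this
    rw [plusBlock_mulVec (by omega) a ha] at this
    exact this.symm
  have hmi : ∀ i : ℕ, i < (k + 2) / 2 → b i - b (k + 1 - i) = 0 := by
    intro i hi
    have := congrFun key (Sum.inl (Sum.inr ⟨i, hi⟩))
    simp only [Sum.elim_inl, Sum.elim_inr] at this
    rw [minusBlock_mulVec (by omega) b hb] at this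
    exact this.symm
  have hz : ∀ i : ℕ, i < k → a (i + 1) = m * b (i + 1) := by
    intro i hi
    have := congrFun key (Sum.inr ⟨i, hi⟩)
    simp only [Sum.elim_inr, Pi.sub_apply, Pi.smul_apply, smul_eq_mul] at this
    rw [zeroId_mulVec, zeroId_mulVec] at this
    exact sub_eq_zero.mp this.symm
  have hab : ∀ i, 1 ≤ i → i ≤ k → a i = m * b i := by
    intro i h1 h2
    obtain ⟨j, rfl⟩ := Nat.exists_eq_add_of_le' h1
    exact hz j (by omega)
  have hlow : ∀ i, 1 ≤ i → 2 * i ≤ k + 1 → b i = 0 ∧ b (k + 1 - i) = 0 := by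
    intro i h1 h2
    have h3 := hp i (by omega)
    split_ifs at h3 with h4
    · rw [hab i h1 (by omega)] at h3
      have h5 : b i = 0 := (mul_eq_zero.mp h3).resolve_left hm
      exact ⟨h5, by rw [show k + 1 - i = i by omega]; exact h5⟩
    · have h5 := hmi i (by omega)
      rw [hab i h1 (by omega), hab (k + 1 - i) (by omega) (by omega)] at h3
      rw [sub_eq_zero] at h5
      rw [← h5, ← two_mul] at h3
      have h6 : b i = 0 := by simpa [hm] using h3
      exact ⟨h6, by rw [← h5]; exact h6⟩
  have hb0 : b 0 = 0 := by
    have := hmi 0 (by omega)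
    simpa [hb (k + 1) le_rfl (by omega)] using this
  have ha0 : a 0 = 0 := by
    have := hp 0 (by omega)
    rw [if_neg (by omega)] at this
    simpa [ha (k + 1) le_rfl (by omega)] using this
  have hball : ∀ i, i ≤ k → b i = 0 := by
    intro i hi
    rcases Nat.eq_zero_or_pos i with rfl | h
    · exact hb0
    · by_cases h2 : 2 * i ≤ k + 1
      · exact (hlow i h h2).1
      · have := (hlow (k + 1 - i) (by omega) (by omega)).2
        rwa [show k + 1 - (k + 1 - i) = i by omega] at this
  have haall : ∀ i, i ≤ k → a i = 0 := by
    intro i hi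
    rcases Nat.eq_zero_or_pos i with rfl | h
    · exact ha0
    · rw [hab i h hi, hball i hi, mul_zero]
  rw [hxe]
  ext (j | j)
  · exact haall j (by omega)
  · exact hball j (by omega)

/-- One step of the Schur–Cohn algorithm on the coefficients of a polynomial of formal
degree `N`. -/
def schurStep (N : ℕ) (f : ℕ → K) (j : ℕ) : K :=
  (f j - f N / f 0 * f (N - j)) / (1 + f N / f 0)

/-- With `γ = f_{k+1} / f_0` and `s` the Schur step, `s_i - s_{k+1-i} = f_i - f_{k+1-i}`, while `s_i
+ s_{k+1-i}` is `f_i + f_{k+1-i}` times `(1 - γ) / (1 + γ)`, a factor that `m` compensates. The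
system asks for exactly these two identities and for proportional halves; `s_{k+1} = 0` accounts for
the lost column. -/
theorem inv_matP_mulVec_matQ [CharZero K] {k : ℕ} (μ : K) (f : ℕ → K) (hμ : μ ≠ 0)
    (h0 : f 0 ≠ 0) (hp : 1 + f (k + 1) / f 0 ≠ 0) (hm : 1 - f (k + 1) / f 0 ≠ 0)
    {m : K} (hme : m = μ * ((1 + f (k + 1) / f 0) / (1 - f (k + 1) / f 0))) :
    (matP k m)⁻¹ *ᵥ (matQ K k *ᵥ
      Sum.elim (fun j : Fin (k + 2) => μ * f j) (fun j : Fin (k + 2) => f j)) =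
      Sum.elim (fun j : Fin (k + 1) => m * schurStep (k + 1) f j)
        (fun j : Fin (k + 1) => schurStep (k + 1) f j) := by
  have hm0 : m ≠ 0 := by
    rw [hme]
    exact mul_ne_zero hμ (div_ne_zero hp hm)
  have hu : IsUnit (matP k m).det := (Matrix.isUnit_iff_isUnit_det _).mp (isUnit_matP k hm0)
  suffices h : matQ K k *ᵥ
      Sum.elim (fun j : Fin (k + 2) => μ * f j) (fun j : Fin (k + 2) => f j) =
      matP k m *ᵥ Sum.elim (fun j : Fin (k + 1) => m * schurStep (k + 1) f j)
        (fun j : Fin (k + 1) => schurStep (k + 1) f j) by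
    rw [h, Matrix.mulVec_mulVec, Matrix.nonsing_inv_mul _ hu, Matrix.one_mulVec]
  have hs : schurStep (k + 1) f (k + 1) = 0 := by
    simp [schurStep, h0]
  have hs' : ∀ j, k + 1 ≤ j → j < k + 2 → schurStep (k + 1) f j = 0 := by
    intro j h1 h2
    rw [show j = k + 1 by omega, hs]
  suffices h : (matQ K k *ᵥ
      Sum.elim (fun j : Fin (k + 2) => μ * f j) (fun j : Fin (k + 2) => f j)) ∘ rowEquiv k =
      (matP k m *ᵥ Sum.elim (fun j : Fin (k + 1) => m * schurStep (k + 1) f j)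
        (fun j : Fin (k + 1) => schurStep (k + 1) f j)) ∘ rowEquiv k from
    (rowEquiv k).surjective.injective_comp_right h
  rw [matP_mulVec, matQ_mulVec]
  ext ((i | i) | i)
  · simp only [Sum.elim_inl]
    rw [plusBlock_mulVec le_rfl (fun j => μ * f j) (by omega),
      plusBlock_mulVec (by omega) (fun j => m * schurStep (k + 1) f j)
        (fun j h1 h2 => by simp [hs' j h1 h2])]
    have hi := i.2
    split_ifs with h
    · simp only [schurStep, show k + 1 - (i : ℕ) = i by omega, hme]
      generalize f (k + 1) / f 0 = γ at *
      field_simp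
    · simp only [schurStep, show k + 1 - (k + 1 - (i : ℕ)) = i by omega, hme]
      generalize f (k + 1) / f 0 = γ at *
      field_simp
      ring
  · simp only [Sum.elim_inl, Sum.elim_inr]
    rw [minusBlock_mulVec le_rfl f (by omega),
      minusBlock_mulVec (by omega) (schurStep (k + 1) f) hs']
    have hi := i.2
    simp only [schurStep, show k + 1 - (k + 1 - (i : ℕ)) = i by omega]
    generalize f (k + 1) / f 0 = γ at *
    field_simp
    ring
  · simp only [Sum.elim_inr, Pi.zero_apply, Pi.sub_apply, Pi.smul_apply, smul_eq_mul]
    rw [zeroId_mulVec (fun j => m * schurStep (k + 1) f j),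
      zeroId_mulVec (fun j => schurStep (k + 1) f j), sub_self]

/-- The iterates of the Schur–Cohn algorithm, starting from `initEntry g c t`. -/
def schurSeq (g : ℕ) (c : Fin (g + 1) → K) (t : K) : ℕ → ℕ → K
  | 0 => initEntry g c t
  | n + 1 => schurStep (2 * g - n) (schurSeq g c t n)

/-- The `n`-th reflection coefficient. -/
def reflCoeff (g : ℕ) (c : Fin (g + 1) → K) (t : K) (n : ℕ) : K :=
  schurSeq g c t n (2 * g - n) / schurSeq g c t n 0

/-- The factor by which the halves of `vec g c t n` differ. -/
def halfRatio (g : ℕ) (c : Fin (g + 1) → K) (t : K) (n : ℕ) : K :=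
  if n = 0 then 1 else mCoeff g c t n

theorem schurSeq_succ_zero {g : ℕ} {c : Fin (g + 1) → K} {t : K} {n : ℕ}
    (h0 : schurSeq g c t n 0 ≠ 0) (hp : 1 + reflCoeff g c t n ≠ 0) :
    schurSeq g c t (n + 1) 0 = schurSeq g c t n 0 * (1 - reflCoeff g c t n) := by
  have h1 : schurSeq g c t n (2 * g - n) = reflCoeff g c t n * schurSeq g c t n 0 := by
    rw [reflCoeff, div_mul_cancel₀ _ h0]
  simp only [schurSeq, schurStep, Nat.sub_zero]
  rw [show schurSeq g c t n (2 * g - n) / schurSeq g c t n 0 = reflCoeff g c t n from rfl, h1]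
  field_simp
  ring

/-- Dividing `μ (f_0 + f_N) / (f_0 - f_N)` through by `f_0`. The case `γ = 1` is allowed: both sides
are then `0`. -/
theorem mCoeff_succ {g : ℕ} {c : Fin (g + 1) → K} {t : K} {n : ℕ} (hn : n < 2 * g)
    (h0 : schurSeq g c t n 0 ≠ 0)
    (hv : vec g c t n (2 * g - n) = Sum.elim
      (fun j : Fin (2 * g - n + 1) => halfRatio g c t n * schurSeq g c t n j)
      (fun j : Fin (2 * g - n + 1) => schurSeq g c t n j)) :
    mCoeff g c t (n + 1) =
      halfRatio g c t n * ((1 + reflCoeff g c t n) / (1 - reflCoeff g c t n)) := by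
  obtain ⟨k, hk⟩ : ∃ k, 2 * g - n = k + 1 := ⟨2 * g - n - 1, by omega⟩
  have hk' : 2 * g - (n + 1) = k := by omega
  rw [mCoeff, hk']
  simp only [reflCoeff]
  rw [hk] at hv ⊢
  rw [hv]
  simp only [mOf, Sum.elim_inl, Sum.elim_inr, Fin.val_zero, Fin.val_last]
  rw [one_add_div h0, one_sub_div h0, div_div_div_cancel_right₀ h0]
  ring

theorem vec_eq [CharZero K] {g : ℕ} {c : Fin (g + 1) → K} {t : K}
    (hc : c 0 ≠ 0) (ht : t ≠ 0) (n : ℕ) (hn : n ≤ 2 * g)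
    (hm : ∀ i, 1 ≤ i → i ≤ n → mCoeff g c t i ≠ 0) :
    schurSeq g c t n 0 ≠ 0 ∧
    vec g c t n (2 * g - n) = Sum.elim
      (fun j : Fin (2 * g - n + 1) => halfRatio g c t n * schurSeq g c t n j)
      (fun j : Fin (2 * g - n + 1) => schurSeq g c t n j) := by
  induction n with
  | zero =>
    refine ⟨?_, ?_⟩
    · simpa [schurSeq, initEntry, ht] using hc
    · ext (j | j) <;> simp [vec, halfRatio, schurSeq]
  | succ n ih =>
    obtain ⟨h0, hv⟩ := ih (by omega) (fun i h1 h2 => hm i h1 (by omega))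
    have hmc := mCoeff_succ (by omega) h0 hv
    have hne := hm (n + 1) (by omega) le_rfl
    have hne' := hne
    rw [hmc] at hne'
    obtain ⟨hμ, hdiv⟩ := mul_ne_zero_iff.mp hne'
    -- As `x / 0 = 0`, a nonzero `m` excludes both `γ = -1` and `γ = 1`.
    obtain ⟨hp, hq⟩ := div_ne_zero_iff.mp hdiv
    refine ⟨?_, ?_⟩
    · rw [schurSeq_succ_zero h0 hp]
      exact mul_ne_zero h0 hq
    · have hr : halfRatio g c t (n + 1) = mCoeff g c t (n + 1) := by simp [halfRatio]
      have hmo : mCoeff g c t (n + 1) = mOf (vec g c t n (2 * g - (n + 1) + 1)) := rfl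
      obtain ⟨k, hk⟩ : ∃ k, 2 * g - n = k + 1 := ⟨2 * g - n - 1, by omega⟩
      have hk' : 2 * g - (n + 1) = k := by omega
      rw [hr]
      simp only [reflCoeff] at hmc hp hq
      simp only [schurSeq]
      rw [hk'] at hmo ⊢
      rw [hk] at hv hmc hp hq ⊢
      rw [vec, ← hmo, hv]
      exact inv_matP_mulVec_matQ _ _ hμ h0 hp hq hmc

theorem initEntry_zero (g : ℕ) (c : Fin (g + 1) → K) (t : K) :
    initEntry g c t 0 = c 0 * t ^ g := by simp [initEntry]

theorem initEntry_last (g : ℕ) (c : Fin (g + 1) → K) (t : K) :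
    initEntry g c t (2 * g) = c 0 * (t ^ g)⁻¹ := by
  simp only [initEntry]
  congr 1
  · congr 1
    ext
    simp
  · rw [← zpow_natCast, ← _root_.zpow_neg]
    congr 1
    push_cast
    ring

/-- The initial halves coincide and `c 0` cancels, so the first quotient of `m`'s carries no
condition. -/
theorem mCoeff_one {g : ℕ} (hg : 0 < g) {c : Fin (g + 1) → K} {t : K} (hc : c 0 ≠ 0) :
    mCoeff g c t 1 = mCoeff g c t 0 := by
  obtain ⟨k, hk⟩ : ∃ k, 2 * g = k + 1 := ⟨2 * g - 1, by omega⟩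
  have hk' : 2 * g - (0 + 1) = k := by omega
  rw [show mCoeff g c t 1 = mOf (vec g c t 0 (2 * g - (0 + 1) + 1)) from rfl, hk']
  simp only [mOf, vec, Sum.elim_inl, Sum.elim_inr, Fin.val_zero, Fin.val_last]
  rw [← hk, initEntry_zero, initEntry_last, ← mul_add, ← mul_sub, mul_div_mul_left _ _ hc, mCoeff]

/-- Passing from `n` to `n + 2` adds one factor, so the `R`'s determine the individual quotients of
consecutive `m`'s; the convention `R_0 = 1` starts the even chain. -/
theorem R_add_two (g : ℕ) (c : Fin (g + 1) → K) (t : K) (n : ℕ) :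
    R g c t (n + 2) = R g c t n * (mCoeff g c t (n + 2) / mCoeff g c t (n + 1)) := by
  rcases Nat.even_or_odd' n with ⟨r, rfl | rfl⟩
  · rcases r with _ | r
    · simp [R]
    · have h1 : (2 * (r + 1) + 2 - 1) / 2 + 1 = (r + 1) + 1 := by omega
      have h2 : (2 * (r + 1) - 1) / 2 + 1 = r + 1 := by omega
      rw [R, if_neg (by omega), if_neg (by omega), h1, Finset.prod_range_succ, R,
        if_neg (by omega), if_neg (by omega), h2]
  · have h1 : (2 * r + 1 + 2 - 1) / 2 + 1 = (r + 1) + 1 := by omega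
    have h2 : (2 * r + 1 - 1) / 2 + 1 = r + 1 := by omega
    rw [R, if_neg (by omega), if_pos (by omega), h1, Finset.prod_range_succ, R,
      if_neg (by omega), if_pos (by omega), h2]
    rfl

theorem R_zero (g : ℕ) (c : Fin (g + 1) → K) (t : K) : R g c t 0 = 1 := by simp [R]

theorem R_one (g : ℕ) (c : Fin (g + 1) → K) (t : K) :
    R g c t 1 = mCoeff g c t 1 / mCoeff g c t 0 := by simp [R]

end LinearAlgebra

/-! ### Polynomials without zeros in the closed unit disc -/

section Stability

/-- The polynomial with real coefficients `f 0, …, f N`, as a function on `ℂ`. -/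
def evalTrunc (N : ℕ) (f : ℕ → ℝ) (x : ℂ) : ℂ := ∑ j ∈ Finset.range (N + 1), (f j : ℂ) * x ^ j

/-- No zeros in the closed unit disc. -/
def DiscStable (N : ℕ) (f : ℕ → ℝ) : Prop := ∀ x : ℂ, ‖x‖ ≤ 1 → evalTrunc N f x ≠ 0

theorem evalTrunc_zero (N : ℕ) (f : ℕ → ℝ) : evalTrunc N f 0 = f 0 := by
  rw [evalTrunc, Finset.sum_eq_single_of_mem 0 (by simp)]
  · simp
  · intro j _ hj
    simp [hj]

theorem DiscStable.apply_zero_ne_zero {N : ℕ} {f : ℕ → ℝ} (h : DiscStable N f) : f 0 ≠ 0 := by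
  have := h 0 (by simp)
  rw [evalTrunc_zero] at this
  exact_mod_cast this

theorem evalTrunc_reflect (N : ℕ) (f : ℕ → ℝ) {x : ℂ} (hx : x ≠ 0) :
    evalTrunc N (fun j => f (N - j)) x = x ^ N * evalTrunc N f x⁻¹ := by
  rw [evalTrunc, evalTrunc, Finset.mul_sum, ← Finset.sum_range_reflect]
  apply Finset.sum_congr rfl
  intro j hj
  have hj' : j ≤ N := by simpa [Nat.lt_succ_iff] using hj
  rw [show N - (N + 1 - 1 - j) = j by omega, show N + 1 - 1 - j = N - j by omega,
    ← Nat.sub_add_cancel hj', pow_add]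
  rw [Nat.add_sub_cancel, inv_pow]
  field_simp

theorem evalTrunc_conj (N : ℕ) (f : ℕ → ℝ) (x : ℂ) :
    evalTrunc N f ((starRingEnd ℂ) x) = (starRingEnd ℂ) (evalTrunc N f x) := by
  simp [evalTrunc]

/-- The Blaschke estimate: the left side is `|1 - r x̄|`, and `|x - r|² - |1 - r x̄|² = (1 -
|x|²)(|r|² - 1)`. -/
theorem norm_inv_conj_sub_mul_norm_le {x r : ℂ} (hx0 : x ≠ 0) (hx : ‖x‖ ≤ 1) (hr : 1 ≤ ‖r‖) :
    ‖((starRingEnd ℂ) x)⁻¹ - r‖ * ‖x‖ ≤ ‖x - r‖ := by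
  have hc : (starRingEnd ℂ) x ≠ 0 := by simpa using hx0
  have h1 : ‖((starRingEnd ℂ) x)⁻¹ - r‖ * ‖x‖ = ‖1 - r * (starRingEnd ℂ) x‖ := by
    rw [← Complex.norm_conj x, ← norm_mul, sub_mul, inv_mul_cancel₀ hc]
  rw [h1]
  apply (sq_le_sq₀ (norm_nonneg _) (norm_nonneg _)).mp
  rw [← Complex.normSq_eq_norm_sq, ← Complex.normSq_eq_norm_sq]
  have h2 : Complex.normSq x ≤ 1 := by
    rw [Complex.normSq_eq_norm_sq]; exact pow_le_one₀ (norm_nonneg _) hx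
  have h3 : 1 ≤ Complex.normSq r := by
    rw [Complex.normSq_eq_norm_sq]; exact one_le_pow₀ hr
  simp only [Complex.normSq_apply, Complex.sub_re, Complex.sub_im, Complex.mul_re, Complex.mul_im,
    Complex.conj_re, Complex.conj_im, Complex.one_re, Complex.one_im] at *
  nlinarith [mul_nonneg (sub_nonneg.mpr h2) (sub_nonneg.mpr h3)]

theorem norm_prod_sub_mul_pow_le {x y : ℂ} {b : ℝ} (hb : 0 ≤ b) (s : Multiset ℂ)
    (h : ∀ r ∈ s, ‖y - r‖ * b ≤ ‖x - r‖) :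
    ‖(s.map fun r => y - r).prod‖ * b ^ s.card ≤ ‖(s.map fun r => x - r).prod‖ := by
  induction s using Multiset.induction_on with
  | empty => simp
  | cons r s ih =>
    simp only [Multiset.map_cons, Multiset.prod_cons, norm_mul, Multiset.card_cons, pow_succ]
    have h1 := h r (Multiset.mem_cons_self r s)
    have h2 := ih fun r' hr' => h r' (Multiset.mem_cons_of_mem hr')
    calc _ = (‖y - r‖ * b) * (‖(s.map fun r => y - r).prod‖ * b ^ s.card) := by ring
      _ ≤ _ := mul_le_mul h1 h2 (by positivity) (by positivity)

theorem one_lt_norm_prod (s : Multiset ℂ) (hs : s ≠ 0) (h : ∀ r ∈ s, 1 < ‖r‖) :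
    1 < ‖(s.map fun r => 0 - r).prod‖ := by
  induction s using Multiset.induction_on with
  | empty => exact absurd rfl hs
  | cons r s ih =>
    simp only [Multiset.map_cons, Multiset.prod_cons, norm_mul, zero_sub, norm_neg]
    have h1 := h r (Multiset.mem_cons_self r s)
    by_cases hs0 : s = 0
    · simpa [hs0] using h1
    · have h2 := ih hs0 fun r' hr' => h r' (Multiset.mem_cons_of_mem hr')
      simp only [zero_sub] at h2
      exact one_lt_mul_of_lt_of_le h1 h2.le

theorem DiscStable.exists_factorization {N : ℕ} {f : ℕ → ℝ} (h : DiscStable N f) :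
    ∃ (a : ℂ) (s : Multiset ℂ), s.card ≤ N ∧ (∀ r ∈ s, 1 < ‖r‖) ∧
      (∀ x, evalTrunc N f x = a * (s.map fun r => x - r).prod) ∧
      (f N ≠ 0 → s.card = N ∧ a = f N) := by
  let p : ℂ[X] := ∑ j ∈ Finset.range (N + 1), C (f j : ℂ) * X ^ j
  have hev : ∀ x, p.eval x = evalTrunc N f x := by
    intro x
    simp [p, evalTrunc, eval_finsetSum]
  have hdeg : p.natDegree ≤ N := by
    apply natDegree_sum_le_of_forall_le
    intro j hj
    exact (natDegree_C_mul_X_pow_le _ _).trans (by simpa [Nat.lt_succ_iff] using hj)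
  have hcoeff : p.coeff N = f N := by
    simp [p, finsetSum_coeff, coeff_C_mul, coeff_X_pow]
  have hsp : p.Splits := IsAlgClosed.splits p
  have hcard : p.roots.card = p.natDegree := hsp.natDegree_eq_card_roots.symm
  have hp0 : p ≠ 0 := by
    intro hp
    have := h 0 (by simp)
    rw [← hev, hp] at this
    simp at this
  refine ⟨p.leadingCoeff, p.roots, by omega, ?_, ?_, ?_⟩
  · intro r hr
    by_contra hlt
    rw [mem_roots hp0, IsRoot.def, hev] at hr
    exact h r (not_lt.mp hlt) hr
  · intro x
    rw [← hev]
    conv_lhs => rw [hsp.eq_prod_roots]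
    simp [eval_mul, eval_multiset_prod, Multiset.map_map]
  · intro hf
    have : p.natDegree = N := by
      apply le_antisymm hdeg
      apply le_natDegree_of_ne_zero
      rw [hcoeff]
      exact_mod_cast hf
    refine ⟨by omega, ?_⟩
    rw [leadingCoeff, this, hcoeff]

/-- Since the coefficients are real, the reflected polynomial has modulus `|x|^N |f(1/x̄)|`, which
is compared with `|f(x)|` root by root. If the true degree is below `N`, the surplus powers of `|x|
≤ 1` only help. -/
theorem DiscStable.norm_reflect_le {N : ℕ} {f : ℕ → ℝ} (h : DiscStable N f) {x : ℂ}
    (hx0 : x ≠ 0) (hx : ‖x‖ ≤ 1) :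
    ‖evalTrunc N (fun j => f (N - j)) x‖ ≤ ‖evalTrunc N f x‖ := by
  obtain ⟨a, s, hs, hr, hf, -⟩ := h.exists_factorization
  have h1 : ‖evalTrunc N f x⁻¹‖ = ‖evalTrunc N f ((starRingEnd ℂ) x)⁻¹‖ := by
    rw [← map_inv₀, evalTrunc_conj, Complex.norm_conj]
  rw [evalTrunc_reflect N f hx0, norm_mul, h1, hf, hf, norm_mul, norm_mul, norm_pow]
  have h2 := norm_prod_sub_mul_pow_le (norm_nonneg x) s
    (fun r hrs => norm_inv_conj_sub_mul_norm_le hx0 hx (hr r hrs).le)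
  calc _ = ‖a‖ * (‖(s.map fun r => ((starRingEnd ℂ) x)⁻¹ - r).prod‖ * ‖x‖ ^ N) := by ring
    _ ≤ ‖a‖ * (‖(s.map fun r => ((starRingEnd ℂ) x)⁻¹ - r).prod‖ * ‖x‖ ^ s.card) := by
      gcongr ?_ * (?_ * ?_)
      exact pow_le_pow_of_le_one (norm_nonneg _) hx hs
    _ ≤ _ := by gcongr

/-- If `f N ≠ 0`, then `f 0 / f N` is up to sign the product of `N > 0` roots of modulus greater
than `1`. -/
theorem DiscStable.abs_last_lt {N : ℕ} (hN : 0 < N) {f : ℕ → ℝ} (h : DiscStable N f) :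
    |f N| < |f 0| := by
  obtain ⟨a, s, hs, hr, hf, hl⟩ := h.exists_factorization
  by_cases hfN : f N = 0
  · rw [hfN, abs_zero, abs_pos]
    exact h.apply_zero_ne_zero
  · obtain ⟨h1, h2⟩ := hl hfN
    have h3 := one_lt_norm_prod s (by rintro rfl; simp at h1; omega) hr
    have h4 : ‖evalTrunc N f 0‖ = |f N| * ‖(s.map fun r => 0 - r).prod‖ := by
      rw [hf, norm_mul, h2, Complex.norm_real, Real.norm_eq_abs]
    rw [evalTrunc_zero, Complex.norm_real, Real.norm_eq_abs] at h4
    rw [h4]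
    exact lt_mul_of_one_lt_right (abs_pos.mpr hfN) h3

end Stability

/-! ### The Schur–Cohn criterion and zeros on the circle -/

section SchurCohn

theorem schurStep_last {K : Type*} [Field K] {N : ℕ} {f : ℕ → K} (h0 : f 0 ≠ 0) :
    schurStep N f N = 0 := by
  simp [schurStep, h0]

theorem evalTrunc_succ_of_eq_zero {k : ℕ} {f : ℕ → ℝ} (h : f (k + 1) = 0) (x : ℂ) :
    evalTrunc (k + 1) f x = evalTrunc k f x := by
  rw [evalTrunc, Finset.sum_range_succ, h]
  simp [evalTrunc]

theorem evalTrunc_schurStep {k : ℕ} {f : ℕ → ℝ} (h0 : f 0 ≠ 0)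
    (hp : 1 + f (k + 1) / f 0 ≠ 0) (x : ℂ) :
    ((1 + f (k + 1) / f 0 : ℝ) : ℂ) * evalTrunc k (schurStep (k + 1) f) x =
      evalTrunc (k + 1) f x -
        ((f (k + 1) / f 0 : ℝ) : ℂ) * evalTrunc (k + 1) (fun j => f (k + 1 - j)) x := by
  rw [← evalTrunc_succ_of_eq_zero (schurStep_last h0)]
  simp only [evalTrunc, Finset.mul_sum]
  rw [← Finset.sum_sub_distrib]
  apply Finset.sum_congr rfl
  intro j _
  rw [← mul_assoc, ← mul_assoc, ← sub_mul, ← Complex.ofReal_mul, ← Complex.ofReal_mul,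
    ← Complex.ofReal_sub, schurStep, mul_div_cancel₀ _ hp]

/-- The Schur step is inverted by eliminating the reflected polynomial. As the step kills the top
coefficient, reflection in degree `k + 1` is `x` times reflection in degree `k`. -/
theorem evalTrunc_eq_of_schurStep {k : ℕ} {f : ℕ → ℝ} (h0 : f 0 ≠ 0)
    (hp : 1 + f (k + 1) / f 0 ≠ 0) {x : ℂ} (hx : x ≠ 0) :
    ((1 - f (k + 1) / f 0 : ℝ) : ℂ) * evalTrunc (k + 1) f x =
      evalTrunc k (schurStep (k + 1) f) x + ((f (k + 1) / f 0 : ℝ) : ℂ) *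
        (x * evalTrunc k (fun j => schurStep (k + 1) f (k - j)) x) := by
  have h1 : x * evalTrunc k (fun j => schurStep (k + 1) f (k - j)) x =
      evalTrunc (k + 1) (fun j => schurStep (k + 1) f (k + 1 - j)) x := by
    rw [evalTrunc_reflect _ _ hx, evalTrunc_reflect _ _ hx,
      evalTrunc_succ_of_eq_zero (schurStep_last h0)]
    ring
  rw [h1, ← evalTrunc_succ_of_eq_zero (schurStep_last h0)]
  simp only [evalTrunc, Finset.mul_sum]
  rw [← Finset.sum_add_distrib]
  apply Finset.sum_congr rfl
  intro j hj
  have hj' : k + 1 - (k + 1 - j) = j := by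
    have := Finset.mem_range.mp hj
    omega
  rw [← mul_assoc, ← mul_assoc, ← add_mul, ← Complex.ofReal_mul, ← Complex.ofReal_mul,
    ← Complex.ofReal_add]
  congr 2
  simp only [schurStep, hj']
  generalize f (k + 1) / f 0 = γ at *
  field_simp
  ring

/-- At a zero of the step `f = γ f*`, with `f*` the reflection of `f`; this contradicts `|γ| < 1`,
`|f*| ≤ |f|` and `f ≠ 0`. The origin is treated through `|f N| < |f 0|`. -/
theorem DiscStable.schurStep {k : ℕ} {f : ℕ → ℝ} (h : DiscStable (k + 1) f) :
    DiscStable k (schurStep (k + 1) f) := by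
  have h0 := h.apply_zero_ne_zero
  have hγ : |f (k + 1) / f 0| < 1 := by
    rw [abs_div, div_lt_one (abs_pos.mpr h0)]
    exact h.abs_last_lt k.succ_pos
  have hp : 1 + f (k + 1) / f 0 ≠ 0 := by linarith [(abs_lt.mp hγ).1]
  intro x hx hs
  have key := evalTrunc_schurStep h0 hp x
  rw [hs, mul_zero, eq_comm, sub_eq_zero] at key
  by_cases hx0 : x = 0
  · subst hx0
    rw [evalTrunc_zero, evalTrunc_zero, ← Complex.ofReal_mul, Complex.ofReal_inj] at key
    have h1 := h.abs_last_lt k.succ_pos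
    rw [key, abs_mul, Nat.sub_zero] at h1
    nlinarith [abs_nonneg (f (k + 1)), abs_nonneg (f (k + 1) / f 0)]
  · have h1 := h.norm_reflect_le hx0 hx
    have h2 : 0 < ‖evalTrunc (k + 1) f x‖ := norm_pos_iff.mpr (h x hx)
    have h3 := congrArg norm key
    rw [norm_mul, Complex.norm_real, Real.norm_eq_abs] at h3
    nlinarith [abs_nonneg (f (k + 1) / f 0)]

/-- At a zero of `f` the step `s` satisfies `s = -γ x s*`, impossible as `|s*| ≤ |s|`, `s ≠ 0` and
`|γ| < 1`. No counting of zeros is needed. -/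
theorem DiscStable.of_schurStep {k : ℕ} {f : ℕ → ℝ} (h0 : f 0 ≠ 0)
    (hγ : |f (k + 1) / f 0| < 1) (h : DiscStable k (SelfReciprocal.schurStep (k + 1) f)) :
    DiscStable (k + 1) f := by
  have hp : 1 + f (k + 1) / f 0 ≠ 0 := by linarith [(abs_lt.mp hγ).1]
  intro x hx hf
  by_cases hx0 : x = 0
  · subst hx0
    rw [evalTrunc_zero] at hf
    exact h0 (by exact_mod_cast hf)
  · have key := evalTrunc_eq_of_schurStep h0 hp hx0
    rw [hf, mul_zero, eq_comm, add_eq_zero_iff_eq_neg] at key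
    have h1 := h.norm_reflect_le hx0 hx
    have h2 : 0 < ‖evalTrunc k (SelfReciprocal.schurStep (k + 1) f) x‖ := norm_pos_iff.mpr (h x hx)
    have h3 := congrArg norm key
    rw [norm_neg, norm_mul, norm_mul, Complex.norm_real, Real.norm_eq_abs] at h3
    have h4 : ‖x‖ * ‖evalTrunc k (fun j => SelfReciprocal.schurStep (k + 1) f (k - j)) x‖ ≤
        ‖evalTrunc k (SelfReciprocal.schurStep (k + 1) f) x‖ :=
      (mul_le_of_le_one_left (norm_nonneg _) hx).trans h1
    nlinarith [abs_nonneg (f (k + 1) / f 0)]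

theorem one_add_ne_zero_of_abs_lt {x : ℝ} (h : |x| < 1) : 1 + x ≠ 0 := by
  linarith [(abs_lt.mp h).1]

theorem one_sub_ne_zero_of_abs_lt {x : ℝ} (h : |x| < 1) : 1 - x ≠ 0 := by
  linarith [(abs_lt.mp h).2]

theorem schurSeq_apply_zero_ne_zero {g : ℕ} {c : Fin (g + 1) → ℝ} {t : ℝ} (hc : c 0 ≠ 0)
    (ht : t ≠ 0) (n : ℕ) (h : ∀ i < n, |reflCoeff g c t i| < 1) : schurSeq g c t n 0 ≠ 0 := by
  induction n with
  | zero => simpa [schurSeq, initEntry, ht] using hc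
  | succ n ih =>
    have h0 := ih fun i hi => h i (by omega)
    have hn := h n (by omega)
    rw [schurSeq_succ_zero h0 (one_add_ne_zero_of_abs_lt hn)]
    exact mul_ne_zero h0 (one_sub_ne_zero_of_abs_lt hn)

/-- The Schur–Cohn criterion. -/
theorem discStable_initEntry_iff {g : ℕ} {c : Fin (g + 1) → ℝ} {t : ℝ} (hc : c 0 ≠ 0)
    (ht : t ≠ 0) :
    DiscStable (2 * g) (initEntry g c t) ↔ ∀ n < 2 * g, |reflCoeff g c t n| < 1 := by
  constructor
  · intro h
    have key : ∀ n ≤ 2 * g, DiscStable (2 * g - n) (schurSeq g c t n) := by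
      intro n
      induction n with
      | zero => exact fun _ => h
      | succ n ih =>
        intro hn
        have h1 := ih (by omega)
        simp only [schurSeq]
        rw [show 2 * g - n = 2 * g - (n + 1) + 1 by omega] at h1 ⊢
        exact h1.schurStep
    intro n hn
    have h1 := key n hn.le
    rw [reflCoeff, abs_div, div_lt_one (abs_pos.mpr h1.apply_zero_ne_zero)]
    exact h1.abs_last_lt (by omega)
  · intro h
    -- Stability climbs back up from the last iterate, a nonzero constant.
    have key : ∀ k n, n + k = 2 * g → DiscStable k (schurSeq g c t n) := by
      intro k
      induction k with
      | zero =>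
        intro n hn x _
        have h0 := schurSeq_apply_zero_ne_zero hc ht n fun i hi => h i (by omega)
        simpa [evalTrunc] using h0
      | succ k ih =>
        intro n hn
        have h0 := schurSeq_apply_zero_ne_zero hc ht n fun i hi => h i (by omega)
        have h1 := h n (by omega)
        have h2 := ih (n + 1) (by omega)
        simp only [schurSeq] at h2
        rw [reflCoeff] at h1
        rw [show 2 * g - n = k + 1 by omega] at h1 h2
        exact DiscStable.of_schurStep h0 h1 h2
    exact key (2 * g) 0 (by omega)

theorem aeval_poly (g : ℕ) (c : Fin (g + 1) → ℝ) (z : ℂ) :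
    aeval z (poly g c) = ∑ j ∈ Finset.range (2 * g + 1),
      (c ⟨min j (2 * g - j), by omega⟩ : ℂ) * z ^ j := by
  rw [show 2 * g + 1 = (g + 1) + g by omega, Finset.sum_range_add, Finset.sum_range_succ,
    ← Finset.sum_range_reflect (fun x => (c ⟨min (g + 1 + x) (2 * g - (g + 1 + x)), by omega⟩ : ℂ) *
      z ^ (g + 1 + x)) g, ← Fin.sum_univ_eq_sum_range, ← Fin.sum_univ_eq_sum_range]
  simp only [poly, map_add, map_sum, map_mul, aeval_C, map_pow, aeval_X, Complex.coe_algebraMap]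
  rw [add_right_comm, ← Finset.sum_add_distrib]
  congr 1
  · apply Finset.sum_congr rfl
    intro k _
    have hk := k.2
    have h1 : (⟨min (k : ℕ) (2 * g - k), by omega⟩ : Fin (g + 1)) = k.castSucc := by
      ext; simp; omega
    have h2 : g + 1 + (g - 1 - (k : ℕ)) = 2 * g - k := by omega
    have h3 : (⟨min (g + 1 + (g - 1 - (k : ℕ))) (2 * g - (g + 1 + (g - 1 - (k : ℕ)))), by omega⟩ :
        Fin (g + 1)) = k.castSucc := by
      ext; simp; omega
    rw [h1, h3, h2]
    ring
  · congr 3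
    ext; simp; omega

theorem evalTrunc_initEntry {g : ℕ} (c : Fin (g + 1) → ℝ) {t : ℝ} (ht : t ≠ 0) (x : ℂ) :
    evalTrunc (2 * g) (initEntry g c t) x = (t : ℂ) ^ g * aeval (x / t) (poly g c) := by
  have ht' : (t : ℂ) ≠ 0 := by exact_mod_cast ht
  rw [aeval_poly, evalTrunc, Finset.mul_sum]
  apply Finset.sum_congr rfl
  intro j _
  rw [initEntry, zpow_sub₀ ht]
  push_cast
  rw [zpow_natCast, zpow_natCast, div_pow]
  field_simp

theorem aeval_inv_poly {g : ℕ} {c : Fin (g + 1) → ℝ} {z : ℂ} (hz : z ≠ 0)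
    (h : aeval z (poly g c) = 0) : aeval z⁻¹ (poly g c) = 0 := by
  have h1 : aeval z (poly g c) = z ^ (2 * g) * aeval z⁻¹ (poly g c) := by
    rw [aeval_poly, aeval_poly, ← Finset.sum_range_reflect, Finset.mul_sum]
    apply Finset.sum_congr rfl
    intro j hj
    have hj' : j ≤ 2 * g := by simpa [Nat.lt_succ_iff] using hj
    have h2 : (⟨min (2 * g + 1 - 1 - j) (2 * g - (2 * g + 1 - 1 - j)), by omega⟩ : Fin (g + 1)) =
        ⟨min j (2 * g - j), by omega⟩ := by
      ext; simp; omega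
    rw [h2, inv_pow, ← div_eq_mul_inv, Nat.add_sub_cancel, pow_sub₀ _ hz hj']
    ring
  rw [h1] at h
  exact (mul_eq_zero.mp h).resolve_left (pow_ne_zero _ hz)

/-- A zero on the circle is dilated to modulus `t > 1`. Conversely, a zero with `0 < |z| < 1` would
land on the unit circle for `t = 1/|z|`; applying this to `1/z` excludes `|z| > 1`. -/
theorem roots_on_circle_iff {g : ℕ} {c : Fin (g + 1) → ℝ} :
    (∀ z : ℂ, aeval z (poly g c) = 0 → ‖z‖ = 1) ↔
      ∀ t : ℝ, 1 < t → DiscStable (2 * g) (initEntry g c t) := by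
  constructor
  · intro h t ht x hx hf
    have ht0 : t ≠ 0 := by linarith
    rw [evalTrunc_initEntry c ht0] at hf
    have h1 := h _ ((mul_eq_zero.mp hf).resolve_left (pow_ne_zero _ (by exact_mod_cast ht0)))
    rw [norm_div, Complex.norm_real, Real.norm_eq_abs, abs_of_pos (by linarith),
      div_eq_one_iff_eq ht0] at h1
    linarith
  · intro h
    have h0 : aeval (0 : ℂ) (poly g c) ≠ 0 := by
      have := h 2 (by norm_num) 0 (by simp)
      rw [evalTrunc_initEntry c (by norm_num)] at this
      simpa using right_ne_zero_of_mul this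
    have hlt : ∀ z : ℂ, aeval z (poly g c) = 0 → 1 ≤ ‖z‖ := by
      intro z hz
      by_contra! hz1
      have hz0 : z ≠ 0 := by rintro rfl; exact h0 hz
      have hn : 0 < ‖z‖ := norm_pos_iff.mpr hz0
      have ht0 : ‖z‖⁻¹ ≠ 0 := by positivity
      refine h ‖z‖⁻¹ ((one_lt_inv₀ hn).mpr hz1) (z * (‖z‖⁻¹ : ℝ)) ?_ ?_
      · rw [norm_mul, Complex.norm_real, norm_inv, norm_norm, mul_inv_cancel₀ hn.ne']
      · rw [evalTrunc_initEntry c ht0, mul_div_cancel_right₀ _ (by exact_mod_cast ht0), hz, mul_zero]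
    intro z hz
    have hz0 : z ≠ 0 := by rintro rfl; exact h0 hz
    have h1 := hlt z⁻¹ (aeval_inv_poly hz0 hz)
    rw [norm_inv, one_le_inv₀ (norm_pos_iff.mpr hz0)] at h1
    exact le_antisymm h1 (hlt z hz)

end SchurCohn

/-! ### Calculus of values of rational functions -/

section Values

variable {g : ℕ} {c : Fin (g + 1) → ℝ} {t : ℝ} {f f' : RatFun g} {y y' : ℝ}

theorem algebraMap_ne_zero_of_aeval {b : MvPolynomial (Option (Fin (g + 1))) ℚ}
    (hb : MvPolynomial.aeval (fun o : Option (Fin (g + 1)) => o.elim t c) b ≠ 0) :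
    algebraMap _ (RatFun g) b ≠ 0 := by
  intro h
  rw [map_eq_zero_iff _ (IsFractionRing.injective _ _)] at h
  exact hb (by rw [h, map_zero])

theorem hasValueAt_algebraMap (a : MvPolynomial (Option (Fin (g + 1))) ℚ) :
    HasValueAt (algebraMap _ (RatFun g) a) c t
      (MvPolynomial.aeval (fun o : Option (Fin (g + 1)) => o.elim t c) a) :=
  ⟨a, 1, by simp, by simp, by simp⟩

theorem hasValueAt_one : HasValueAt (1 : RatFun g) c t 1 := by
  simpa using hasValueAt_algebraMap (c := c) (t := t) (1 : MvPolynomial (Option (Fin (g + 1))) ℚ)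

theorem HasValueAt.add (h : HasValueAt f c t y) (h' : HasValueAt f' c t y') :
    HasValueAt (f + f') c t (y + y') := by
  obtain ⟨a, b, hb, rfl, rfl⟩ := h
  obtain ⟨a', b', hb', rfl, rfl⟩ := h'
  refine ⟨a * b' + b * a', b * b', by simpa using ⟨hb, hb'⟩, ?_, ?_⟩
  · rw [div_add_div _ _ (algebraMap_ne_zero_of_aeval hb) (algebraMap_ne_zero_of_aeval hb')]
    simp only [map_add, map_mul]
  · rw [div_add_div _ _ hb hb']
    simp only [map_add, map_mul]

theorem HasValueAt.neg (h : HasValueAt f c t y) : HasValueAt (-f) c t (-y) := by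
  obtain ⟨a, b, hb, rfl, rfl⟩ := h
  exact ⟨-a, b, hb, by rw [map_neg, neg_div], by rw [map_neg, neg_div]⟩

theorem HasValueAt.sub (h : HasValueAt f c t y) (h' : HasValueAt f' c t y') :
    HasValueAt (f - f') c t (y - y') := by
  rw [sub_eq_add_neg, sub_eq_add_neg]
  exact h.add h'.neg

theorem HasValueAt.mul (h : HasValueAt f c t y) (h' : HasValueAt f' c t y') :
    HasValueAt (f * f') c t (y * y') := by
  obtain ⟨a, b, hb, rfl, rfl⟩ := h
  obtain ⟨a', b', hb', rfl, rfl⟩ := h'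
  refine ⟨a * a', b * b', by simpa using ⟨hb, hb'⟩, ?_, ?_⟩
  · simp only [map_mul, div_mul_div_comm]
  · simp only [map_mul, div_mul_div_comm]

theorem HasValueAt.inv (h : HasValueAt f c t y) (hy : y ≠ 0) : HasValueAt f⁻¹ c t y⁻¹ := by
  obtain ⟨a, b, hb, rfl, rfl⟩ := h
  exact ⟨b, a, (div_ne_zero_iff.mp hy).1, inv_div _ _, inv_div _ _⟩

theorem HasValueAt.div (h : HasValueAt f c t y) (h' : HasValueAt f' c t y') (hy' : y' ≠ 0) :
    HasValueAt (f / f') c t (y / y') := by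
  rw [div_eq_mul_inv, div_eq_mul_inv]
  exact h.mul (h'.inv hy')

theorem HasValueAt.pow (h : HasValueAt f c t y) (n : ℕ) : HasValueAt (f ^ n) c t (y ^ n) := by
  induction n with
  | zero => simpa using hasValueAt_one
  | succ n ih =>
    rw [pow_succ, pow_succ]
    exact ih.mul h

theorem HasValueAt.zpow (h : HasValueAt f c t y) (hy : y ≠ 0) (n : ℤ) :
    HasValueAt (f ^ n) c t (y ^ n) := by
  cases n with
  | ofNat n => simpa using h.pow n
  | negSucc n =>
    rw [zpow_negSucc, zpow_negSucc]
    exact (h.pow _).inv (pow_ne_zero _ hy)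

/-- This transfers identities of the function field to the real point, whatever fractions represent
the two sides. -/
theorem HasValueAt.unique (h : HasValueAt f c t y) (h' : HasValueAt f c t y') : y = y' := by
  obtain ⟨a, b, hb, rfl, rfl⟩ := h
  obtain ⟨a', b', hb', he, rfl⟩ := h'
  rw [div_eq_div_iff (algebraMap_ne_zero_of_aeval hb) (algebraMap_ne_zero_of_aeval hb'),
    ← map_mul, ← map_mul] at he
  have := IsFractionRing.injective _ (RatFun g) he
  rw [div_eq_div_iff hb hb', ← map_mul, ← map_mul, this]

theorem HasValueAt.ne_zero (h : HasValueAt f c t y) (hy : y ≠ 0) : f ≠ 0 := by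
  rintro rfl
  have h0 : HasValueAt (0 : RatFun g) c t 0 := by
    simpa using hasValueAt_algebraMap (c := c) (t := t) (0 : MvPolynomial (Option (Fin (g + 1))) ℚ)
  exact hy (h.unique h0)

theorem PosAt.mul (h : PosAt f c t) (h' : PosAt f' c t) : PosAt (f * f') c t := by
  obtain ⟨y, hv, hy⟩ := h
  obtain ⟨y', hv', hy'⟩ := h'
  exact ⟨y * y', hv.mul hv', mul_pos hy hy'⟩

theorem PosAt.inv (h : PosAt f c t) : PosAt f⁻¹ c t := by
  obtain ⟨y, hv, hy⟩ := h
  exact ⟨y⁻¹, hv.inv hy.ne', inv_pos.mpr hy⟩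

theorem posAt_one : PosAt (1 : RatFun g) c t := ⟨1, hasValueAt_one, one_pos⟩

theorem PosAt.ne_zero (h : PosAt f c t) : f ≠ 0 := by
  obtain ⟨y, hv, hy⟩ := h
  exact hv.ne_zero hy.ne'

end Values

/-! ### Evaluating the generic algorithm at a real point -/

section Generic

variable (g : ℕ)

/-- The indeterminates `c_i`. -/
def genC (i : Fin (g + 1)) : RatFun g :=
  algebraMap (MvPolynomial (Option (Fin (g + 1))) ℚ) (RatFun g) (MvPolynomial.X (some i))

/-- The indeterminate `t`. -/
def genT : RatFun g :=
  algebraMap (MvPolynomial (Option (Fin (g + 1))) ℚ) (RatFun g) (MvPolynomial.X none)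

theorem genC_ne_zero (i : Fin (g + 1)) : genC g i ≠ 0 := by
  rw [genC, Ne, map_eq_zero_iff _ (IsFractionRing.injective _ _)]
  exact MvPolynomial.X_ne_zero _

theorem genT_ne_zero : genT g ≠ 0 := by
  rw [genT, Ne, map_eq_zero_iff _ (IsFractionRing.injective _ _)]
  exact MvPolynomial.X_ne_zero _

instance : CharZero (RatFun g) :=
  charZero_of_injective_algebraMap
    (IsFractionRing.injective (MvPolynomial (Option (Fin (g + 1))) ℚ) (RatFun g))

variable {g} {c : Fin (g + 1) → ℝ} {t : ℝ}

theorem hasValueAt_genC (i : Fin (g + 1)) : HasValueAt (genC g i) c t (c i) := by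
  simpa [genC] using hasValueAt_algebraMap (c := c) (t := t) (MvPolynomial.X (some i))

theorem hasValueAt_genT : HasValueAt (genT g) c t t := by
  simpa [genT] using hasValueAt_algebraMap (c := c) (t := t) (MvPolynomial.X none)

/-- The generic and the numerical algorithm can part only at a vanishing denominator `f 0` or `1 +
γ_i`; the bounds on the earlier `γ_i` exclude both. -/
theorem hasValueAt_schurSeq (hc : c 0 ≠ 0) (ht : t ≠ 0) (n : ℕ)
    (h : ∀ i < n, |reflCoeff g c t i| < 1) (j : ℕ) :
    HasValueAt (schurSeq g (genC g) (genT g) n j) c t (schurSeq g c t n j) := by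
  induction n generalizing j with
  | zero =>
    simp only [schurSeq, initEntry]
    exact (hasValueAt_genC _).mul (hasValueAt_genT.zpow ht _)
  | succ n ih =>
    have ih' := ih fun i hi => h i (by omega)
    have h0 := schurSeq_apply_zero_ne_zero hc ht n fun i hi => h i (by omega)
    have hγ := (ih' (2 * g - n)).div (ih' 0) h0
    exact ((ih' j).sub (hγ.mul (ih' _))).div (hasValueAt_one.add hγ)
      (one_add_ne_zero_of_abs_lt (h n (by omega)))

theorem hasValueAt_reflCoeff (hc : c 0 ≠ 0) (ht : t ≠ 0) (n : ℕ)
    (h : ∀ i < n, |reflCoeff g c t i| < 1) :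
    HasValueAt (reflCoeff g (genC g) (genT g) n) c t (reflCoeff g c t n) :=
  (hasValueAt_schurSeq hc ht n h _).div (hasValueAt_schurSeq hc ht n h 0)
    (schurSeq_apply_zero_ne_zero hc ht n h)

/-- The Cayley transform `y = (1 + x) / (1 - x)`, cleared of its denominator because `x ≠ 1` is not
known beforehand. -/
theorem abs_lt_one_of_mul_one_sub_eq {x y : ℝ} (hy : 0 < y) (h : y * (1 - x) = 1 + x) :
    |x| < 1 := by
  rw [abs_lt]
  constructor <;> by_contra! hx <;> nlinarith

theorem gen_mCoeff_succ {n : ℕ} (hn : n < 2 * g)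
    (hm : ∀ i, 1 ≤ i → i ≤ n → mCoeff g (genC g) (genT g) i ≠ 0) :
    mCoeff g (genC g) (genT g) (n + 1) = halfRatio g (genC g) (genT g) n *
      ((1 + reflCoeff g (genC g) (genT g) n) / (1 - reflCoeff g (genC g) (genT g) n)) := by
  obtain ⟨h0, hv⟩ := vec_eq (genC_ne_zero g 0) (genT_ne_zero g) n hn.le hm
  exact mCoeff_succ hn h0 hv

theorem posAt_ratR_iff :
    (∀ n, 1 ≤ n → n ≤ 2 * g → PosAt (ratR g n) c t) ↔
    ∀ n < 2 * g, PosAt (mCoeff g (genC g) (genT g) (n + 1) / mCoeff g (genC g) (genT g) n) c t := by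
  constructor
  · intro h n hn
    rcases n with _ | n
    · have h1 := h 1 le_rfl (by omega)
      rwa [ratR, R_one] at h1
    · have h2 := h (n + 2) (by omega) (by omega)
      have h1 : PosAt (R g (genC g) (genT g) n) c t := by
        rcases n with _ | n
        · rw [R_zero]; exact posAt_one
        · exact h (n + 1) (by omega) (by omega)
      have h3 : ratR g (n + 2) = R g (genC g) (genT g) n *
        (mCoeff g (genC g) (genT g) (n + 2) / mCoeff g (genC g) (genT g) (n + 1)) :=
          R_add_two _ _ _ _
      rw [h3] at h2
      have h4 := h1.inv.mul h2
      rwa [inv_mul_cancel_left₀ h1.ne_zero] at h4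
  · intro h
    have key : ∀ n ≤ 2 * g, PosAt (R g (genC g) (genT g) n) c t := by
      intro n
      induction n using Nat.twoStepInduction with
      | zero => intro _; rw [R_zero]; exact posAt_one
      | one => intro h1; rw [R_one]; exact h 0 (by omega)
      | more n ih _ =>
        intro hn
        rw [R_add_two]
        exact (ih (by omega)).mul (h (n + 1) (by omega))
    exact fun n _ hn => key n hn

theorem posAt_mCoeff_div_iff (hg : 0 < g) (hc : c 0 ≠ 0) (ht : 1 < t) :
    (∀ n < 2 * g, PosAt (mCoeff g (genC g) (genT g) (n + 1) / mCoeff g (genC g) (genT g) n) c t) ↔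
      ∀ n < 2 * g, |reflCoeff g c t n| < 1 := by
  have ht0 : t ≠ 0 := by linarith
  have hone : mCoeff g (genC g) (genT g) 1 = mCoeff g (genC g) (genT g) 0 :=
    mCoeff_one hg (genC_ne_zero g 0)
  have hr : ∀ n, n ≠ 0 → halfRatio g (genC g) (genT g) n = mCoeff g (genC g) (genT g) n :=
    fun n hn => if_neg hn
  have hzero : |reflCoeff g c t 0| < 1 := by
    have h1 : reflCoeff g c t 0 = (t ^ g)⁻¹ / t ^ g := by
      rw [reflCoeff, schurSeq, Nat.sub_zero, initEntry_zero, initEntry_last, mul_div_mul_left _ _ hc]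
    have h4 : 1 < t ^ g := one_lt_pow₀ ht hg.ne'
    rw [h1, abs_of_pos (by positivity), div_lt_one (by positivity)]
    exact (inv_lt_one_of_one_lt₀ h4).trans h4
  constructor
  · intro h
    have hm : ∀ i, 1 ≤ i → i ≤ 2 * g → mCoeff g (genC g) (genT g) i ≠ 0 := by
      intro i h1 h2
      have h3 := (h (i - 1) (by omega)).ne_zero
      rw [Nat.sub_add_cancel h1] at h3
      exact (div_ne_zero_iff.mp h3).1
    intro n
    induction n using Nat.strong_induction_on with
    | _ n ih =>
      intro hn
      rcases Nat.eq_zero_or_pos n with rfl | hn0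
      · exact hzero
      · have hv := hasValueAt_reflCoeff hc ht0 n fun i hi => ih i hi (by omega)
        obtain ⟨y, hy, hy0⟩ := h n hn
        have h1 := gen_mCoeff_succ hn fun i h1 h2 => hm i h1 (by omega)
        rw [hr n hn0.ne'] at h1
        rw [h1, mul_div_cancel_left₀ _ (hm n hn0 hn.le)] at hy
        -- This is nonvanishing in the function field only; the value at the point could still be
        -- zero, so the product is evaluated instead of the quotient.
        have h2 : 1 - reflCoeff g (genC g) (genT g) n ≠ 0 :=
          (div_ne_zero_iff.mp (hy.ne_zero hy0.ne')).2
        have h3 := hy.mul (hasValueAt_one.sub hv)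
        rw [div_mul_cancel₀ _ h2] at h3
        exact abs_lt_one_of_mul_one_sub_eq hy0 (h3.unique (hasValueAt_one.add hv))
  · intro h
    have hpos : ∀ n < 2 * g, PosAt ((1 + reflCoeff g (genC g) (genT g) n) /
        (1 - reflCoeff g (genC g) (genT g) n)) c t := by
      intro n hn
      have hv := hasValueAt_reflCoeff hc ht0 n fun i hi => h i (by omega)
      have h1 := abs_lt.mp (h n hn)
      exact ⟨_, (hasValueAt_one.add hv).div (hasValueAt_one.sub hv)
        (one_sub_ne_zero_of_abs_lt (h n hn)), div_pos (by linarith) (by linarith)⟩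
    -- A nonzero value at one real point shows each factor of `m_{2g-n}` to be nonzero in the
    -- function field.
    have hm : ∀ n ≤ 2 * g, ∀ i, 1 ≤ i → i ≤ n → mCoeff g (genC g) (genT g) i ≠ 0 := by
      intro n
      induction n with
      | zero => intro _ i h1 h2; omega
      | succ n ih =>
        intro hn i h1 h2
        rcases Nat.lt_or_ge n i with h3 | h3
        · obtain rfl : i = n + 1 := by omega
          have ih' := ih (by omega)
          rw [gen_mCoeff_succ (by omega) ih']
          refine mul_ne_zero ?_ (hpos n (by omega)).ne_zero
          rcases Nat.eq_zero_or_pos n with rfl | hn0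
          · simp [halfRatio]
          · rw [hr n hn0.ne']
            exact ih' n hn0 le_rfl
        · exact ih (by omega) i h1 h3
    intro n hn
    rcases Nat.eq_zero_or_pos n with rfl | hn0
    · rw [hone, div_self (by rw [← hone]; exact hm 1 (by omega) 1 le_rfl le_rfl)]
      exact posAt_one
    · rw [gen_mCoeff_succ hn fun i h1 h2 => hm n hn.le i h1 h2, hr n hn0.ne',
        mul_div_cancel_left₀ _ (hm n hn.le n hn0 le_rfl)]
      exact hpos n hn

end Generic

end SelfReciprocal

end

theorem theorem4 (g : ℕ) (hg : 0 < g) (q : ℝ) (hq : 1 < q)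
    (c : Fin (g + 1) → ℝ) (hc : c 0 ≠ 0) :
    (∀ z : ℂ, Polynomial.aeval z (SelfReciprocal.poly g c) = 0 → ‖z‖ = 1) ↔
      ∀ n : ℕ, 1 ≤ n → n ≤ 2 * g → ∀ ω : ℝ, 0 < ω →
        SelfReciprocal.PosAt (SelfReciprocal.ratR g n) c (q ^ ω) ∧
          SelfReciprocal.PosAt (SelfReciprocal.ratR g n)⁻¹ c (q ^ ω) := by
  have key : ∀ t : ℝ, 1 < t → (SelfReciprocal.DiscStable (2 * g) (SelfReciprocal.initEntry g c t) ↔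
      ∀ n, 1 ≤ n → n ≤ 2 * g → SelfReciprocal.PosAt (SelfReciprocal.ratR g n) c t) := by
    intro t ht
    rw [SelfReciprocal.discStable_initEntry_iff hc (by linarith), SelfReciprocal.posAt_ratR_iff,
      SelfReciprocal.posAt_mCoeff_div_iff hg hc ht]
  rw [SelfReciprocal.roots_on_circle_iff]
  constructor
  · intro h n h1 h2 ω hω
    have ht := Real.one_lt_rpow hq hω
    have h3 := (key _ ht).mp (h _ ht) n h1 h2
    exact ⟨h3, h3.inv⟩
  · intro h t ht
    -- With `ω = log_q t`, the numbers `q^ω` exhaust all `t > 1`.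
    have hω : 0 < Real.logb q t := Real.logb_pos hq ht
    have ht' : q ^ Real.logb q t = t := Real.rpow_logb (by linarith) hq.ne' (by linarith)
    rw [key t ht]
    intro n h1 h2
    have h3 := (h n h1 h2 _ hω).1
    rwa [ht'] at h3
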